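/- Let $\Omega\subset\mathbb{C}^2$ be a bounded pseudoconvex complete Reinhardt domain with $C^\infty$-smooth boundary $b\Omega$. (Complete Reinhardt means: if $z\in\Omega$ and $|w_1|\le|z_1|$, $|w_2|\le|z_2|$, then $w\in\Omega$. Pseudoconvex means: $\Omega$ has a continuous plurisubharmonic exhaustion function.) Let $\mathbb{D}$ be the open unit disk, and let $f,g:\overline{\mathbb{D}}\to\mathbb{C}^2$ be maps that are continuous on $\overline{\mathbb{D}}$, holomorphic on $\mathbb{D}$, and satisfy $f(\mathbb{D})\subset b\Omega$ and $g(\mathbb{D})\subset b\Omega$. Assume that $\overline{f(\mathbb{D})}\cap\overline{g(\mathbb{D})}\neq\emptyset$ and that neither $\overline{f(\mathbb{D})}$ nor $\overline{g(\mathbb{D})}$ meets $\{z_1=0\}\cup\{z_2=0\}$. Then $f(\mathbb{D})$ and $g(\mathbb{D})$ are simultaneously biholomorphically equivalent to analytic disks contained in one complex line: there are an open set $U\subset\mathbb{C}^2$ containing $\overline{f(\mathbb{D})}\cup\overline{g(\mathbb{D})}$, a biholomorphism $T$ from $U$ onto an open subset of $\mathbb{C}^2$, and a complex line (a one-dimensional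 complex affine subspace) $L\subset\mathbb{C}^2$ such that $T(f(\mathbb{D}))$ and $T(g(\mathbb{D}))$ are analytic disks contained in $L$. (An analytic disk is the image of $\mathbb{D}$ under a map to $\mathbb{C}^2$ that is holomorphic on $\mathbb{D}$ and continuous on $\overline{\mathbb{D}}$.) Moreover $L$ is uniquely determined by $T$ and either non-degenerate disk: if $f$ is non-constant, then $L$ is the only complex line containing $T(f(\mathbb{D}))$, and if $g$ is non-constant, then $L$ is the only complex line containing $T(g(\mathbb{D}))$. -/

import Mathlib

open scoped ContDiff

/-- The open unit disk `𝔻` of the complex plane. -/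
def unitDisk : Set ℂ := Metric.ball 0 1

/-- The union of the two coordinate axes `{z₁ = 0} ∪ {z₂ = 0}` of `ℂ²`. -/
def coordinateAxes : Set (ℂ × ℂ) := {z | z.1 = 0 ∨ z.2 = 0}

/-- `Ω ⊆ ℂ²` is a domain: open, connected and non-empty. -/
def IsDomainSet (Ω : Set (ℂ × ℂ)) : Prop := IsOpen Ω ∧ IsConnected Ω

/-- `Ω` is complete Reinhardt: with a point `z` it contains the closed polydisk of all `w` with
`|w₁| ≤ |z₁|` and `|w₂| ≤ |z₂|`. -/
def IsCompleteReinhardt (Ω : Set (ℂ × ℂ)) : Prop :=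
  ∀ z ∈ Ω, ∀ w : ℂ × ℂ, ‖w.1‖ ≤ ‖z.1‖ → ‖w.2‖ ≤ ‖z.2‖ → w ∈ Ω

/-- `Ω` has a `C^∞` boundary: near every boundary point it is a sublevel set `{r < 0}` of a smooth
real function `r` whose (real) differential does not vanish at that point. -/
def HasSmoothBoundary (Ω : Set (ℂ × ℂ)) : Prop :=
  ∀ p ∈ frontier Ω, ∃ (U : Set (ℂ × ℂ)) (r : ℂ × ℂ → ℝ),
    IsOpen U ∧ p ∈ U ∧ ContDiffOn ℝ ∞ r U ∧ fderiv ℝ r p ≠ 0 ∧ Ω ∩ U = {z ∈ U | r z < 0}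

/-- A (finite-valued) plurisubharmonic function on an open set `Ω ⊆ ℂ²`: upper semicontinuous, with
the sub-mean value property on every closed affine disk `{a + ζ b : |ζ| ≤ 1}` inside `Ω`. -/
def IsPlurisubharmonicOn (φ : ℂ × ℂ → ℝ) (Ω : Set (ℂ × ℂ)) : Prop :=
  UpperSemicontinuousOn φ Ω ∧
    ∀ a b : ℂ × ℂ, (∀ ζ : ℂ, ‖ζ‖ ≤ 1 → a + ζ • b ∈ Ω) →
      φ a ≤ Real.circleAverage (fun ζ : ℂ => φ (a + ζ • b)) 0 1

/-- `Ω` is pseudoconvex: it has a continuous plurisubharmonic exhaustion function, that is, one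
all of whose sublevel sets in `Ω` are compact. -/
def IsPseudoconvex (Ω : Set (ℂ × ℂ)) : Prop :=
  ∃ φ : ℂ × ℂ → ℝ, ContinuousOn φ Ω ∧ IsPlurisubharmonicOn φ Ω ∧
    ∀ c : ℝ, IsCompact {z ∈ Ω | φ z ≤ c}

/-- `Γ ⊆ ℂ²` is an analytic disk: the image of `𝔻` under a map holomorphic on `𝔻` and continuous
on the closed disk. -/
def IsAnalyticDisk (Γ : Set (ℂ × ℂ)) : Prop :=
  ∃ F : ℂ → ℂ × ℂ, DiffContOnCl ℂ F unitDisk ∧ F '' unitDisk = Γ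

/-- A complex line in `ℂ²`: a complex affine subspace of complex dimension one. -/
def IsComplexLine (L : AffineSubspace ℂ (ℂ × ℂ)) : Prop :=
  Module.finrank ℂ L.direction = 1

/-- `T` is a biholomorphism from the open set `T.source` onto the open set `T.target`. -/
def IsBiholomorphism (T : OpenPartialHomeomorph (ℂ × ℂ) (ℂ × ℂ)) : Prop :=
  DifferentiableOn ℂ T T.source ∧ DifferentiableOn ℂ T.symm T.target

open Complex Topology Filter

/-- The logarithmic coordinates `(log |z₁|, log |z₂|)` of a point of `ℂ²`. -/
noncomputable def logMap (z : ℂ × ℂ) : ℝ × ℝ := (Real.log ‖z.1‖, Real.log ‖z.2‖)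

theorem abs_log_norm_one_add_sub_re_le {w : ℂ} (hw : ‖w‖ ≤ 1 / 2) :
    |Real.log ‖1 + w‖ - w.re| ≤ ‖w‖ ^ 2 := by
  have h := Complex.norm_log_one_add_sub_self_le (z := w) (by linarith)
  have h2 : (1 - ‖w‖)⁻¹ ≤ 2 := by
    rw [inv_le_comm₀ (by linarith) two_pos]; linarith
  have h3 := Complex.abs_re_le_norm (Complex.log (1 + w) - w)
  rw [Complex.sub_re, Complex.log_re] at h3
  have : ‖w‖ ^ 2 * (1 - ‖w‖)⁻¹ ≤ ‖w‖ ^ 2 * 2 := by gcongr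
  linarith

theorem circleAverage_re_eq_of_differentiable {H : ℂ → ℂ} {U : Set ℂ}
    (hsub : Metric.closedBall 0 1 ⊆ U) (hH : DifferentiableOn ℂ H U) :
    CircleIntegrable (fun ζ => (H ζ).re) 0 1 ∧
      Real.circleAverage (fun ζ => (H ζ).re) 0 1 = (H 0).re := by
  have hd : DiffContOnCl ℂ H (Metric.ball 0 |(1 : ℝ)|) := by
    rw [abs_one]
    exact hH.diffContOnCl_ball hsub
  have hint : CircleIntegrable H 0 1 := by
    apply ContinuousOn.circleIntegrable zero_le_one
    exact hH.continuousOn.mono (Metric.sphere_subset_closedBall.trans hsub)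
  have h1 := hd.circleAverage
  have h2 := Complex.reCLM.circleAverage_comp_comm hint
  refine ⟨?_, ?_⟩
  · apply ContinuousOn.circleIntegrable zero_le_one
    exact Complex.continuous_re.comp_continuousOn
      (hH.continuousOn.mono (Metric.sphere_subset_closedBall.trans hsub))
  · rw [h1] at h2
    exact h2

theorem norm_real_mul_lt_one {t : ℝ} (ht : |t| < 1 / 2) {ζ : ℂ} (hζ : ‖ζ‖ < 2) :
    ‖(t : ℂ) * ζ‖ < 1 := by
  rw [norm_mul, Complex.norm_real, Real.norm_eq_abs]
  nlinarith [norm_nonneg ζ, abs_nonneg t]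

theorem circleAverage_log_touching {t₁ t₂ : ℝ} (h₁ : |t₁| < 1 / 2) (h₂ : |t₂| < 1 / 2)
    (a b d : ℝ) :
    CircleIntegrable (fun ζ : ℂ => a * Real.log ‖1 + (t₁ : ℂ) * ζ‖
      + b * Real.log ‖1 + (t₂ : ℂ) * ζ‖ - d * (ζ ^ 2).re) 0 1 ∧
    Real.circleAverage (fun ζ : ℂ => a * Real.log ‖1 + (t₁ : ℂ) * ζ‖
      + b * Real.log ‖1 + (t₂ : ℂ) * ζ‖ - d * (ζ ^ 2).re) 0 1 = 0 := by
  have hdlog : ∀ t : ℝ, |t| < 1 / 2 →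
      DifferentiableOn ℂ (fun ζ => Complex.log (1 + (t : ℂ) * ζ)) (Metric.ball 0 2) := by
    intro t ht
    apply DifferentiableOn.clog
    · fun_prop
    · intro ζ hζ
      exact Complex.mem_slitPlane_of_norm_lt_one (norm_real_mul_lt_one ht (by simpa using hζ))
  have hHd : DifferentiableOn ℂ (fun ζ : ℂ => (a : ℂ) * Complex.log (1 + (t₁ : ℂ) * ζ)
      + (b : ℂ) * Complex.log (1 + (t₂ : ℂ) * ζ) - (d : ℂ) * ζ ^ 2) (Metric.ball 0 2) :=
    (((differentiableOn_const _).mul (hdlog t₁ h₁)).add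
      ((differentiableOn_const _).mul (hdlog t₂ h₂))).sub (by fun_prop)
  have := circleAverage_re_eq_of_differentiable
    (Metric.closedBall_subset_ball (by norm_num)) hHd
  simpa only [Complex.sub_re, Complex.add_re, Complex.re_ofReal_mul, Complex.log_re, mul_zero,
    add_zero, norm_one, Real.log_one, ne_eq, OfNat.ofNat_ne_zero, not_false_eq_true, zero_pow,
    Complex.zero_re, sub_zero] using this

theorem abs_log_norm_one_add_real_mul_le {t : ℝ} (ht : |t| < 1 / 2) {ζ : ℂ} (hζ : ‖ζ‖ = 1) :
    |Real.log ‖1 + (t : ℂ) * ζ‖ - t * ζ.re| ≤ t ^ 2 := by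
  have hn : ‖(t : ℂ) * ζ‖ = |t| := by
    rw [norm_mul, hζ, Complex.norm_real, Real.norm_eq_abs, mul_one]
  have := abs_log_norm_one_add_sub_re_le (w := (t : ℂ) * ζ) (by rw [hn]; exact ht.le)
  rwa [hn, sq_abs, Complex.re_ofReal_mul] at this

theorem log_norm_add_mul_sub {ε q : ℝ} (hq : |ε * q| < 1 / 2) {v ζ : ℂ} (hv : v ≠ 0)
    (hζ : ‖ζ‖ = 1) :
    Real.log ‖v + ζ * (ε * (v * q))‖ - Real.log ‖v‖ =
      Real.log ‖1 + ((ε * q : ℝ) : ℂ) * ζ‖ := by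
  have : v + ζ * (ε * (v * q)) = v * (1 + ((ε * q : ℝ) : ℂ) * ζ) := by push_cast; ring
  rw [this, norm_mul, Real.log_mul (norm_ne_zero_iff.2 hv)]
  · ring
  · exact norm_ne_zero_iff.2 (Complex.slitPlane_ne_zero (Complex.mem_slitPlane_of_norm_lt_one
      (norm_real_mul_lt_one hq (by rw [hζ]; norm_num))))

theorem sq_re_of_norm_eq_one {ζ : ℂ} (hζ : ‖ζ‖ = 1) : (ζ ^ 2).re = 2 * ζ.re ^ 2 - 1 := by
  have := Complex.sq_norm ζ
  rw [hζ, Complex.normSq_apply] at this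
  rw [pow_two, Complex.mul_re]
  nlinarith

/-- The elementary estimate behind the failure of a strictly concave upper touching function. -/
theorem quadratic_touching_bound {p₁ p₂ ε w₁ w₂ x δ N : ℝ} (hδ : 0 ≤ δ) (hN : 0 ≤ N)
    (h₁ : |w₁ - ε * p₁ * x| ≤ (ε * p₁) ^ 2) (h₂ : |w₂ - ε * p₂ * x| ≤ (ε * p₂) ^ 2) :
    -δ * (p₁ * w₁ + p₂ * w₂) ^ 2 + N * (-p₂ * w₁ + p₁ * w₂) ^ 2 ≤
      (δ + N) * ((|p₁| + |p₂|) ^ 3) ^ 2 * ε ^ 4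
        - δ * (ε * (p₁ ^ 2 + p₂ ^ 2) * x) ^ 2 / 2 := by
  set e₁ := w₁ - ε * p₁ * x with he₁
  set e₂ := w₂ - ε * p₂ * x with he₂
  set c := (|p₁| + |p₂|) ^ 3 with hc
  have a₁ := abs_nonneg p₁
  have a₂ := abs_nonneg p₂
  have hA : |p₁ * e₁ + p₂ * e₂| ≤ ε ^ 2 * c := by
    calc |p₁ * e₁ + p₂ * e₂| ≤ |p₁| * |e₁| + |p₂| * |e₂| := by
          rw [← abs_mul, ← abs_mul]; exact abs_add_le _ _
      _ ≤ |p₁| * (ε * p₁) ^ 2 + |p₂| * (ε * p₂) ^ 2 := by gcongr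
      _ = ε ^ 2 * (|p₁| * |p₁| ^ 2 + |p₂| * |p₂| ^ 2) := by rw [sq_abs, sq_abs]; ring
      _ ≤ ε ^ 2 * c := by
          gcongr
          rw [hc]
          have := mul_nonneg a₁ a₂
          nlinarith [mul_nonneg this a₁, mul_nonneg this a₂]
  have hB : |-p₂ * e₁ + p₁ * e₂| ≤ ε ^ 2 * c := by
    calc |-p₂ * e₁ + p₁ * e₂| ≤ |p₂| * |e₁| + |p₁| * |e₂| := by
          rw [← abs_neg p₂, ← abs_mul, ← abs_mul]; exact abs_add_le _ _
      _ ≤ |p₂| * (ε * p₁) ^ 2 + |p₁| * (ε * p₂) ^ 2 := by gcongr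
      _ = ε ^ 2 * (|p₂| * |p₁| ^ 2 + |p₁| * |p₂| ^ 2) := by rw [sq_abs, sq_abs]; ring
      _ ≤ ε ^ 2 * c := by
          gcongr
          rw [hc]
          have := mul_nonneg a₁ a₂
          nlinarith [mul_nonneg this a₁, mul_nonneg this a₂, pow_nonneg a₁ 3, pow_nonneg a₂ 3]
  have hA2 := sq_le_sq' (abs_le.1 hA).1 (abs_le.1 hA).2
  have hB2 := sq_le_sq' (abs_le.1 hB).1 (abs_le.1 hB).2
  have eB : -p₂ * w₁ + p₁ * w₂ = -p₂ * e₁ + p₁ * e₂ := by rw [he₁, he₂]; ring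
  have eA : p₁ * w₁ + p₂ * w₂ = ε * (p₁ ^ 2 + p₂ ^ 2) * x + (p₁ * e₁ + p₂ * e₂) := by
    rw [he₁, he₂]; ring
  have hA3 : (ε * (p₁ ^ 2 + p₂ ^ 2) * x) ^ 2 / 2 - (ε ^ 2 * c) ^ 2 ≤ (p₁ * w₁ + p₂ * w₂) ^ 2 := by
    rw [eA]
    nlinarith [sq_nonneg (ε * (p₁ ^ 2 + p₂ ^ 2) * x + 2 * (p₁ * e₁ + p₂ * e₂))]
  rw [eB]
  have k1 := mul_le_mul_of_nonneg_left hA3 hδ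
  have k2 := mul_le_mul_of_nonneg_left hB2 hN
  nlinarith

/-- A continuous plurisubharmonic function cannot be touched from above, at a point off the axes,
by a quadratic function of the logarithmic coordinates that is strictly concave in some real
direction. -/
theorem IsPlurisubharmonicOn.not_touching {φ : ℂ × ℂ → ℝ} {Ω : Set (ℂ × ℂ)} (hΩ : IsOpen Ω)
    (hφ : IsPlurisubharmonicOn φ Ω) (hc : ContinuousOn φ Ω) {z : ℂ × ℂ} (hz : z ∈ Ω)
    (hz₁ : z.1 ≠ 0) (hz₂ : z.2 ≠ 0) {p : ℝ × ℝ} (hp : p ≠ 0) {δ N : ℝ} (hδ : 0 < δ) (hN : 0 ≤ N)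
    (α β : ℝ)
    (h : ∀ᶠ w in 𝓝 z, φ w ≤ φ z
      + α * (p.1 * ((logMap w).1 - (logMap z).1) + p.2 * ((logMap w).2 - (logMap z).2))
      + β * (-p.2 * ((logMap w).1 - (logMap z).1) + p.1 * ((logMap w).2 - (logMap z).2))
      - δ * (p.1 * ((logMap w).1 - (logMap z).1) + p.2 * ((logMap w).2 - (logMap z).2)) ^ 2
      + N * (-p.2 * ((logMap w).1 - (logMap z).1) + p.1 * ((logMap w).2 - (logMap z).2)) ^ 2) :
    False := by
  obtain ⟨p₁, p₂⟩ := p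
  obtain ⟨z₁, z₂⟩ := z
  dsimp only at hz₁ hz₂ h
  have hS : 0 < p₁ ^ 2 + p₂ ^ 2 := by
    by_contra hcon
    apply hp
    have h1 : p₁ = 0 := by nlinarith [sq_nonneg p₁, sq_nonneg p₂]
    have h2 : p₂ = 0 := by nlinarith [sq_nonneg p₁, sq_nonneg p₂]
    rw [h1, h2]; rfl
  set S := p₁ ^ 2 + p₂ ^ 2 with hSdef
  set D : ℝ → ℂ → ℂ × ℂ := fun ε ζ => (z₁, z₂) + ζ • ((ε : ℂ) • (z₁ * p₁, z₂ * p₂)) with hD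
  set c := (|p₁| + |p₂|) ^ 3 with hcdef
  set q : ℂ × ℂ → ℝ := fun w => φ (z₁, z₂)
      + α * (p₁ * ((logMap w).1 - (logMap (z₁, z₂)).1) + p₂ * ((logMap w).2 - (logMap (z₁, z₂)).2))
      + β * (-p₂ * ((logMap w).1 - (logMap (z₁, z₂)).1) + p₁ * ((logMap w).2 - (logMap (z₁, z₂)).2))
      - δ * (p₁ * ((logMap w).1 - (logMap (z₁, z₂)).1)
        + p₂ * ((logMap w).2 - (logMap (z₁, z₂)).2)) ^ 2
      + N * (-p₂ * ((logMap w).1 - (logMap (z₁, z₂)).1)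
        + p₁ * ((logMap w).2 - (logMap (z₁, z₂)).2)) ^ 2 with hq
  have e1 : ∀ᶠ ε in 𝓝[>] (0 : ℝ), ∀ ζ ∈ Metric.closedBall (0 : ℂ) 1, D ε ζ ∈ Ω ∧
      φ (D ε ζ) ≤ q (D ε ζ) := by
    have hev := (hΩ.eventually_mem hz).and h
    have : ∀ ζ ∈ Metric.closedBall (0 : ℂ) 1, ∀ᶠ r : ℝ × ℂ in 𝓝 ((0 : ℝ), ζ), D r.1 r.2 ∈ Ω ∧
        φ (D r.1 r.2) ≤ q (D r.1 r.2) := by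
      intro ζ _
      have hcont : Continuous fun r : ℝ × ℂ => D r.1 r.2 := by
        rw [hD]; fun_prop
      have ht : Tendsto (fun r : ℝ × ℂ => D r.1 r.2) (𝓝 (0, ζ)) (𝓝 (z₁, z₂)) := by
        convert hcont.tendsto (0, ζ) using 2
        simp [hD]
      exact ht.eventually hev
    exact ((isCompact_closedBall (0 : ℂ) 1).eventually_forall_of_forall_eventually this).filter_mono
      nhdsWithin_le_nhds
  have e2 : ∀ᶠ ε in 𝓝[>] (0 : ℝ), ε * |p₁| < 1 / 2 ∧ ε * |p₂| < 1 / 2 ∧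
      (δ + N) * c ^ 2 * ε ^ 2 < δ * S ^ 2 / 4 := by
    apply Filter.Eventually.filter_mono nhdsWithin_le_nhds
    have t1 : Tendsto (fun ε : ℝ => ε * |p₁|) (𝓝 0) (𝓝 (0 * |p₁|)) :=
      (continuous_id.mul continuous_const).tendsto 0
    have t2 : Tendsto (fun ε : ℝ => ε * |p₂|) (𝓝 0) (𝓝 (0 * |p₂|)) :=
      (continuous_id.mul continuous_const).tendsto 0
    have t3 : Tendsto (fun ε : ℝ => (δ + N) * c ^ 2 * ε ^ 2) (𝓝 0)
        (𝓝 ((δ + N) * c ^ 2 * 0 ^ 2)) :=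
      (continuous_const.mul (continuous_id.pow 2)).tendsto 0
    have k : (0 : ℝ) < δ * S ^ 2 / 4 := by positivity
    refine (t1.eventually_lt_const (by norm_num)).and
      ((t2.eventually_lt_const (by norm_num)).and (t3.eventually_lt_const (by simpa using k)))
  obtain ⟨ε, ⟨he1, hε1, hε2, hε3⟩, hε0⟩ := ((e1.and e2).and self_mem_nhdsWithin).exists
  replace hε0 : 0 < ε := hε0
  have hmean := hφ.2 (z₁, z₂) ((ε : ℂ) • (z₁ * p₁, z₂ * p₂))
    (fun ζ hζ => (he1 ζ (by simpa using hζ)).1)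
  set κ : ℝ := (δ + N) * c ^ 2 * ε ^ 4 - δ * (ε * S) ^ 2 / 4 with hκ
  have hκ0 : κ < 0 := by
    have : κ = ε ^ 2 * ((δ + N) * c ^ 2 * ε ^ 2 - δ * S ^ 2 / 4) := by rw [hκ]; ring
    rw [this]
    exact mul_neg_of_pos_of_neg (by positivity) (by linarith)
  have ht₁ : |ε * p₁| < 1 / 2 := by rw [abs_mul, abs_of_pos hε0]; exact hε1
  have ht₂ : |ε * p₂| < 1 / 2 := by rw [abs_mul, abs_of_pos hε0]; exact hε2
  obtain ⟨hHi, hHavg⟩ := circleAverage_log_touching ht₁ ht₂ (α * p₁ - β * p₂) (α * p₂ + β * p₁)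
    (δ * (ε * S) ^ 2 / 4)
  set H : ℂ → ℝ := fun ζ => (α * p₁ - β * p₂) * Real.log ‖1 + ((ε * p₁ : ℝ) : ℂ) * ζ‖
      + (α * p₂ + β * p₁) * Real.log ‖1 + ((ε * p₂ : ℝ) : ℂ) * ζ‖
      - (δ * (ε * S) ^ 2 / 4) * (ζ ^ 2).re with hH
  have hpt : ∀ ζ ∈ Metric.sphere (0 : ℂ) |1|, φ (D ε ζ) ≤ (φ (z₁, z₂) + κ) + H ζ := by
    intro ζ hζ
    rw [abs_one] at hζ
    have hζ1 : ‖ζ‖ = 1 := mem_sphere_zero_iff_norm.1 hζ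
    refine (he1 ζ (Metric.sphere_subset_closedBall hζ)).2.trans ?_
    have l1 := log_norm_add_mul_sub ht₁ hz₁ hζ1
    have l2 := log_norm_add_mul_sub ht₂ hz₂ hζ1
    have hb := quadratic_touching_bound hδ.le hN (abs_log_norm_one_add_real_mul_le ht₁ hζ1)
      (abs_log_norm_one_add_real_mul_le ht₂ hζ1)
    rw [← hSdef, ← hcdef] at hb
    have hL1 : (logMap (D ε ζ)).1 - (logMap (z₁, z₂)).1 =
      Real.log ‖1 + ((ε * p₁ : ℝ) : ℂ) * ζ‖ := l1
    have hL2 : (logMap (D ε ζ)).2 - (logMap (z₁, z₂)).2 =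
      Real.log ‖1 + ((ε * p₂ : ℝ) : ℂ) * ζ‖ := l2
    simp only [hq, hH, hL1, hL2, sq_re_of_norm_eq_one hζ1, hκ]
    generalize Real.log ‖1 + ((ε * p₁ : ℝ) : ℂ) * ζ‖ = w₁ at hb ⊢
    generalize Real.log ‖1 + ((ε * p₂ : ℝ) : ℂ) * ζ‖ = w₂ at hb ⊢
    linarith
  have hφint : CircleIntegrable (fun ζ => φ (D ε ζ)) 0 1 := by
    apply ContinuousOn.circleIntegrable zero_le_one
    apply hc.comp
    · rw [hD]; fun_prop
    · intro ζ hζ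
      exact (he1 ζ (Metric.sphere_subset_closedBall hζ)).1
  have hcint : CircleIntegrable (fun _ : ℂ => φ (z₁, z₂) + κ) 0 1 :=
    continuousOn_const.circleIntegrable zero_le_one
  have hfin := Real.circleAverage_mono hφint (hcint.add hHi) hpt
  rw [Real.circleAverage_add hcint hHi, Real.circleAverage_const, hHavg] at hfin
  have : φ (z₁, z₂) ≤ Real.circleAverage (fun ζ => φ (D ε ζ)) 0 1 := hmean
  linarith

/-- The positive point `(eˢ, eᵗ)` of `ℂ²` with logarithmic coordinates `(s, t)`. -/
noncomputable def expPoint (x : ℝ × ℝ) : ℂ × ℂ := ((Real.exp x.1 : ℂ), (Real.exp x.2 : ℂ))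

/-- The logarithmic image of a set, in the coordinates `(log |z₁|, log |z₂|)`. -/
def logDomain (Ω : Set (ℂ × ℂ)) : Set (ℝ × ℝ) := expPoint ⁻¹' Ω

/-- The points off the coordinate axes whose logarithmic coordinates lie in `X`. -/
def logFiber (X : Set (ℝ × ℝ)) : Set (ℂ × ℂ) := {z | z.1 ≠ 0 ∧ z.2 ≠ 0 ∧ logMap z ∈ X}

theorem continuous_expPoint : Continuous expPoint := by
  unfold expPoint
  fun_prop

theorem isOpen_logDomain {Ω : Set (ℂ × ℂ)} (hΩ : IsOpen Ω) : IsOpen (logDomain Ω) :=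
  hΩ.preimage continuous_expPoint

theorem norm_expPoint_fst (x : ℝ × ℝ) : ‖(expPoint x).1‖ = Real.exp x.1 := by
  simp only [expPoint, Complex.norm_real, Real.norm_eq_abs, Real.abs_exp]

theorem norm_expPoint_snd (x : ℝ × ℝ) : ‖(expPoint x).2‖ = Real.exp x.2 := by
  simp only [expPoint, Complex.norm_real, Real.norm_eq_abs, Real.abs_exp]

theorem logMap_expPoint (x : ℝ × ℝ) : logMap (expPoint x) = x := by
  simp only [logMap, norm_expPoint_fst, norm_expPoint_snd, Real.log_exp]

theorem expPoint_mem_logFiber {x : ℝ × ℝ} {X : Set (ℝ × ℝ)} (hx : x ∈ X) :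
    expPoint x ∈ logFiber X := by
  refine ⟨?_, ?_, by rwa [logMap_expPoint]⟩ <;>
    exact Complex.ofReal_ne_zero.2 (Real.exp_pos _).ne'

theorem IsCompleteReinhardt.mem_logDomain_iff {Ω : Set (ℂ × ℂ)} (h : IsCompleteReinhardt Ω)
    {z : ℂ × ℂ} (h₁ : z.1 ≠ 0) (h₂ : z.2 ≠ 0) : logMap z ∈ logDomain Ω ↔ z ∈ Ω := by
  have e₁ : ‖(expPoint (logMap z)).1‖ = ‖z.1‖ := by
    rw [norm_expPoint_fst]; exact Real.exp_log (norm_pos_iff.2 h₁)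
  have e₂ : ‖(expPoint (logMap z)).2‖ = ‖z.2‖ := by
    rw [norm_expPoint_snd]; exact Real.exp_log (norm_pos_iff.2 h₂)
  exact ⟨fun hz => h _ hz _ e₁.ge e₂.ge, fun hz => h _ hz _ e₁.le e₂.le⟩

theorem IsCompleteReinhardt.logDomain_mono {Ω : Set (ℂ × ℂ)} (h : IsCompleteReinhardt Ω)
    {x y : ℝ × ℝ} (hx : x ∈ logDomain Ω) (hyx : y ≤ x) : y ∈ logDomain Ω := by
  refine h _ hx _ ?_ ?_
  · rw [norm_expPoint_fst, norm_expPoint_fst]; exact Real.exp_le_exp.2 hyx.1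
  · rw [norm_expPoint_snd, norm_expPoint_snd]; exact Real.exp_le_exp.2 hyx.2

theorem IsCompleteReinhardt.logFiber_subset {Ω : Set (ℂ × ℂ)} (h : IsCompleteReinhardt Ω)
    {X : Set (ℝ × ℝ)} (hX : X ⊆ logDomain Ω) : logFiber X ⊆ Ω :=
  fun _ hz => (h.mem_logDomain_iff hz.1 hz.2.1).1 (hX hz.2.2)

theorem continuousAt_logMap {z : ℂ × ℂ} (h₁ : z.1 ≠ 0) (h₂ : z.2 ≠ 0) : ContinuousAt logMap z := by
  have a : ContinuousAt (fun z : ℂ × ℂ => Real.log ‖z.1‖) z :=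
    continuous_fst.norm.continuousAt.log (norm_ne_zero_iff.2 h₁)
  have b : ContinuousAt (fun z : ℂ × ℂ => Real.log ‖z.2‖) z :=
    continuous_snd.norm.continuousAt.log (norm_ne_zero_iff.2 h₂)
  exact a.prodMk b

theorem continuousOn_logMap_logFiber (X : Set (ℝ × ℝ)) : ContinuousOn logMap (logFiber X) :=
  fun _ hz => (continuousAt_logMap hz.1 hz.2.1).continuousWithinAt

theorem isCompact_logFiber {X : Set (ℝ × ℝ)} (hX : IsCompact X) : IsCompact (logFiber X) := by
  let E : (ℝ × ℝ) × ℝ × ℝ → ℂ × ℂ := fun q =>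
    (Complex.exp (q.1.1 + q.2.1 * I), Complex.exp (q.1.2 + q.2.2 * I))
  have hE : Continuous E := by fun_prop
  have himg : logFiber X = E '' (X ×ˢ (Set.Icc (-Real.pi) Real.pi ×ˢ Set.Icc (-Real.pi) Real.pi)) := by
    ext z
    constructor
    · rintro ⟨h₁, h₂, hz⟩
      refine ⟨(logMap z, z.1.arg, z.2.arg), ⟨hz, ?_, ?_⟩, ?_⟩
      · exact ⟨(Complex.neg_pi_lt_arg _).le, Complex.arg_le_pi _⟩
      · exact ⟨(Complex.neg_pi_lt_arg _).le, Complex.arg_le_pi _⟩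
      · ext1
        · exact Complex.exp_log h₁
        · exact Complex.exp_log h₂
    · rintro ⟨q, ⟨hq, -⟩, rfl⟩
      refine ⟨Complex.exp_ne_zero _, Complex.exp_ne_zero _, ?_⟩
      have : logMap (E q) = q.1 := by
        simp [logMap, E, Complex.norm_exp]
      rwa [this]
  rw [himg]
  exact (hX.prod (isCompact_Icc.prod isCompact_Icc)).image hE

/-- A large multiple of a non-negative penalty `ψ` pushes `φ` below any level that `φ` stays below
on the zero set of `ψ`. -/
theorem IsCompact.exists_sub_mul_lt {X : Type*} [TopologicalSpace X] [T2Space X] {K : Set X} (hK : IsCompact K)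
    {φ ψ : X → ℝ} (hφ : ContinuousOn φ K) (hψ : ContinuousOn ψ K) (hψ0 : ∀ x ∈ K, 0 ≤ ψ x) {M : ℝ}
    (h : ∀ x ∈ K, ψ x = 0 → φ x < M) : ∃ N : ℝ, 0 ≤ N ∧ ∀ x ∈ K, φ x - N * ψ x < M := by
  rcases K.eq_empty_or_nonempty with rfl | hne
  · exact ⟨0, le_rfl, by simp⟩
  obtain ⟨x₀, hx₀, hmax⟩ := hK.exists_isMaxOn hne hφ
  have hK' : IsCompact (K ∩ φ ⁻¹' Set.Ici M) :=
    hK.of_isClosed_subset (hφ.preimage_isClosed_of_isClosed hK.isClosed isClosed_Ici)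
      Set.inter_subset_left
  rcases (K ∩ φ ⁻¹' Set.Ici M).eq_empty_or_nonempty with he | hne'
  · refine ⟨0, le_rfl, fun x hx => ?_⟩
    by_contra hcon
    have : x ∈ K ∩ φ ⁻¹' Set.Ici M := ⟨hx, by simpa using hcon⟩
    simp [he] at this
  obtain ⟨x₁, hx₁, hmin⟩ := hK'.exists_isMinOn hne' (hψ.mono Set.inter_subset_left)
  have hm : 0 < ψ x₁ := lt_of_le_of_ne (hψ0 x₁ hx₁.1)
    fun h0 => absurd (h x₁ hx₁.1 h0.symm) (not_lt.2 hx₁.2)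
  have hB : M ≤ φ x₀ := le_trans hx₁.2 (hmax hx₁.1)
  have hN : 0 ≤ (φ x₀ - M) / ψ x₁ + 1 := by
    have := div_nonneg (sub_nonneg.2 hB) hm.le
    linarith
  refine ⟨(φ x₀ - M) / ψ x₁ + 1, hN, fun x hx => ?_⟩
  by_cases hxM : φ x < M
  · nlinarith [mul_nonneg hN (hψ0 x hx)]
  · have h1 : ψ x₁ ≤ ψ x := hmin ⟨hx, not_lt.1 hxM⟩
    have h2 : φ x ≤ φ x₀ := hmax hx
    have h3 : ((φ x₀ - M) / ψ x₁ + 1) * ψ x₁ = φ x₀ - M + ψ x₁ := by field_simp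
    have h4 := mul_le_mul_of_nonneg_left h1 hN
    linarith

/-- Maximum principle along logarithmic segments. -/
theorem IsPlurisubharmonicOn.le_on_logSegment {φ : ℂ × ℂ → ℝ} {Ω : Set (ℂ × ℂ)} (hΩ : IsOpen Ω)
    (hrein : IsCompleteReinhardt Ω) (hφ : IsPlurisubharmonicOn φ Ω) (hc : ContinuousOn φ Ω)
    {P p : ℝ × ℝ} (hseg : ∀ r ∈ Set.Icc (0 : ℝ) 1, P + r • p ∈ logDomain Ω) {C : ℝ}
    (h0 : ∀ z ∈ logFiber {P}, φ z ≤ C) (h1 : ∀ z ∈ logFiber {P + p}, φ z ≤ C) :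
    ∀ r ∈ Set.Icc (0 : ℝ) 1, φ (expPoint (P + r • p)) ≤ C := by
  intro r₀ hr₀
  rcases eq_or_ne p 0 with rfl | hp
  · apply h0
    rw [smul_zero, add_zero]
    exact expPoint_mem_logFiber rfl
  by_contra! hcon
  set zs := expPoint (P + r₀ • p) with hzs
  obtain ⟨P₁, P₂⟩ := P
  obtain ⟨p₁, p₂⟩ := p
  set D := p₁ ^ 2 + p₂ ^ 2 with hDdef
  have hD : 0 < D := by
    by_contra hcon
    apply hp
    have h1 : p₁ = 0 := by nlinarith [sq_nonneg p₁, sq_nonneg p₂]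
    have h2 : p₂ = 0 := by nlinarith [sq_nonneg p₁, sq_nonneg p₂]
    rw [h1, h2]; rfl
  set A : ℝ × ℝ → ℝ := fun x => p₁ * (x.1 - P₁) + p₂ * (x.2 - P₂) with hA
  set B : ℝ × ℝ → ℝ := fun x => -p₂ * (x.1 - P₁) + p₁ * (x.2 - P₂) with hB
  have hAc : Continuous A := by fun_prop
  have hBc : Continuous B := by fun_prop
  let Ψ : ℝ × ℝ → ℝ × ℝ := fun q => (P₁, P₂) + q.2 • (p₁, p₂) + q.1 • (-p₂, p₁)
  have hΨc : Continuous Ψ := by fun_prop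
  have hΨA : ∀ q, A (Ψ q) = q.2 * D := by
    intro q; simp [A, Ψ, hDdef]; ring
  have hΨB : ∀ q, B (Ψ q) = q.1 * D := by
    intro q; simp [B, Ψ, hDdef]; ring
  have hΨinv : ∀ x, Ψ (B x / D, A x / D) = x := by
    intro x
    ext <;> simp [A, B, Ψ] <;> field_simp <;> rw [hDdef] <;> ring
  obtain ⟨η, hη, hηω⟩ : ∃ η > 0, ∀ s : ℝ, |s| ≤ η → ∀ r ∈ Set.Icc (0 : ℝ) 1,
      Ψ (s, r) ∈ logDomain Ω := by
    have : ∀ᶠ s in 𝓝 (0 : ℝ), ∀ r ∈ Set.Icc (0 : ℝ) 1, Ψ (s, r) ∈ logDomain Ω := by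
      apply isCompact_Icc.eventually_forall_of_forall_eventually
      intro r hr
      have hmem : Ψ (0, r) ∈ logDomain Ω := by simpa [Ψ] using hseg r hr
      exact hΨc.continuousAt.eventually ((isOpen_logDomain hΩ).mem_nhds hmem)
    obtain ⟨η, hη, h⟩ := Metric.eventually_nhds_iff.1 this
    refine ⟨η / 2, by positivity, fun s hs => h ?_⟩
    rw [Real.dist_eq, sub_zero]
    linarith
  set X : Set (ℝ × ℝ) := {x | 0 ≤ A x ∧ A x ≤ D ∧ |B x| ≤ η * D} with hX
  have hXimg : X = Ψ '' (Set.Icc (-η) η ×ˢ Set.Icc 0 1) := by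
    ext x
    constructor
    · rintro ⟨ha, hb, hcB⟩
      refine ⟨(B x / D, A x / D), ⟨abs_le.1 ?_, div_nonneg ha hD.le, (div_le_one hD).2 hb⟩, hΨinv x⟩
      rwa [abs_div, abs_of_pos hD, div_le_iff₀ hD]
    · rintro ⟨q, ⟨hq1, hq2⟩, rfl⟩
      refine ⟨?_, ?_, ?_⟩
      · rw [hΨA]; exact mul_nonneg hq2.1 hD.le
      · rw [hΨA]; nlinarith [hq2.2]
      · rw [hΨB, abs_mul, abs_of_pos hD]
        exact mul_le_mul_of_nonneg_right (abs_le.2 hq1) hD.le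
  have hXc : IsCompact X := by
    rw [hXimg]; exact (isCompact_Icc.prod isCompact_Icc).image hΨc
  have hXω : X ⊆ logDomain Ω := by
    rw [hXimg]
    rintro _ ⟨q, ⟨hq1, hq2⟩, rfl⟩
    exact hηω q.1 (abs_le.2 hq1) q.2 hq2
  have hKΩ := hrein.logFiber_subset hXω
  have hKc := isCompact_logFiber hXc
  have hlog := continuousOn_logMap_logFiber X
  have hφK := hc.mono hKΩ
  set Y : Set (ℝ × ℝ) := X ∩ {x | A x = 0 ∨ A x = D ∨ |B x| = η * D} with hY
  have hYc : IsCompact Y := by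
    apply hXc.inter_right
    exact (isClosed_eq hAc continuous_const).union ((isClosed_eq hAc continuous_const).union
      (isClosed_eq hBc.abs continuous_const))
  have hYX : logFiber Y ⊆ logFiber X := fun z hz => ⟨hz.1, hz.2.1, hz.2.2.1⟩
  obtain ⟨N, hN, hNlt⟩ := (isCompact_logFiber hYc).exists_sub_mul_lt (φ := φ)
    (ψ := fun z => B (logMap z) ^ 2) (M := (φ zs + C) / 2) (hφK.mono hYX)
    ((hBc.comp_continuousOn (continuousOn_logMap_logFiber Y)).pow 2) (fun _ _ => sq_nonneg _) (by
      intro z hz hz0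
      have hB0 : B (logMap z) = 0 := by simpa using hz0
      have hle : φ z ≤ C := by
        have hx := hΨinv (logMap z)
        rcases hz.2.2.2 with h | h | h
        · apply h0 z ⟨hz.1, hz.2.1, ?_⟩
          rw [hB0, h] at hx
          simpa [Ψ] using hx.symm
        · apply h1 z ⟨hz.1, hz.2.1, ?_⟩
          rw [hB0, h, div_self hD.ne'] at hx
          simpa [Ψ] using hx.symm
        · rw [hB0, abs_zero] at h
          nlinarith [mul_pos hη hD]
      linarith)
  set δ := (φ zs - C) / D ^ 2 with hδdef
  have hδ : 0 < δ := div_pos (by linarith) (by positivity)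
  set G : ℂ × ℂ → ℝ := fun z => φ z - δ * (A (logMap z) * (D - A (logMap z)))
    - N * B (logMap z) ^ 2 with hG
  have hGc : ContinuousOn G (logFiber X) := by
    have ha := hAc.comp_continuousOn hlog
    have hb := hBc.comp_continuousOn hlog
    exact (hφK.sub (continuousOn_const.mul (ha.mul (continuousOn_const.sub ha)))).sub
      (continuousOn_const.mul (hb.pow 2))
  have hzsX : zs ∈ logFiber X := by
    apply expPoint_mem_logFiber
    rw [hXimg]
    exact ⟨(0, r₀), ⟨by constructor <;> simp [hη.le], hr₀⟩, by simp [Ψ]⟩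
  obtain ⟨z, hz, hmax⟩ := hKc.exists_isMaxOn ⟨zs, hzsX⟩ hGc
  have hGs : (φ zs + C) / 2 < G zs := by
    have hlz : logMap zs = Ψ (0, r₀) := by
      rw [hzs, logMap_expPoint]; simp [Ψ]
    have hBz : B (logMap zs) = 0 := by rw [hlz, hΨB, zero_mul]
    have h4 : A (logMap zs) * (D - A (logMap zs)) ≤ D ^ 2 / 4 := by
      nlinarith [sq_nonneg (2 * A (logMap zs) - D)]
    have h5 := mul_le_mul_of_nonneg_left h4 hδ.le
    have h6 : δ * (D ^ 2 / 4) = (φ zs - C) / 4 := by rw [hδdef]; field_simp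
    simp only [hG, hBz]
    linarith
  have hzY : logMap z ∉ Y := by
    intro hzY
    have := hNlt z ⟨hz.1, hz.2.1, hzY⟩
    have hle : G zs ≤ G z := hmax hzsX
    have hAz : 0 ≤ A (logMap z) * (D - A (logMap z)) :=
      mul_nonneg hz.2.2.1 (sub_nonneg.2 hz.2.2.2.1)
    have : G z ≤ φ z - N * B (logMap z) ^ 2 := by
      simp only [hG]; linarith [mul_nonneg hδ.le hAz]
    linarith
  have hA0 : 0 < A (logMap z) :=
    lt_of_le_of_ne hz.2.2.1 fun h => hzY ⟨hz.2.2, Or.inl h.symm⟩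
  have hAD : A (logMap z) < D :=
    lt_of_le_of_ne hz.2.2.2.1 fun h => hzY ⟨hz.2.2, Or.inr (Or.inl h)⟩
  have hBD : |B (logMap z)| < η * D :=
    lt_of_le_of_ne hz.2.2.2.2 fun h => hzY ⟨hz.2.2, Or.inr (Or.inr h)⟩
  have hzc := continuousAt_logMap hz.1 hz.2.1
  have hnear : ∀ᶠ w in 𝓝 z, w ∈ logFiber X := by
    filter_upwards [continuous_fst.continuousAt.eventually_ne hz.1,
      continuous_snd.continuousAt.eventually_ne hz.2.1,
      (hAc.continuousAt.comp hzc).eventually_const_lt hA0,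
      (hAc.continuousAt.comp hzc).eventually_lt_const hAD,
      (hBc.abs.continuousAt.comp hzc).eventually_lt_const hBD] with w w1 w2 w3 w4 w5
    exact ⟨w1, w2, w3.le, w4.le, w5.le⟩
  refine hφ.not_touching hΩ hc (hKΩ hz) hz.1 hz.2.1 hp hδ hN (δ * (D - 2 * A (logMap z)))
    (2 * N * B (logMap z)) ?_
  filter_upwards [hnear] with w hw
  have hle : G w ≤ G z := hmax hw
  simp only [hG, hA, hB] at hle ⊢
  nlinarith [hle]

/-- The logarithmic image of a pseudoconvex complete Reinhardt domain is convex. -/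
theorem IsPseudoconvex.convex_logDomain {Ω : Set (ℂ × ℂ)} (hpsc : IsPseudoconvex Ω)
    (hΩ : IsOpen Ω) (hrein : IsCompleteReinhardt Ω) : Convex ℝ (logDomain Ω) := by
  obtain ⟨φ, hc, hφ, hcomp⟩ := hpsc
  intro P hP Q hQ
  suffices h : ∀ r ∈ Set.Icc (0 : ℝ) 1, P + r • (Q - P) ∈ logDomain Ω by
    intro a b ha hb hab
    have := h b ⟨hb, by linarith⟩
    have e : P + b • (Q - P) = a • P + b • Q := by
      rw [show a = 1 - b by linarith]; module
    rwa [e] at this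
  set e : ℝ × ℝ := (1, 1) with he
  set Λ : ℝ := |Q.1 - P.1| + |Q.2 - P.2| with hΛ
  have hΛ0 : 0 ≤ Λ := by positivity
  have hdown : ∀ {x : ℝ × ℝ} {l : ℝ}, x ∈ logDomain Ω → 0 ≤ l → x - l • e ∈ logDomain Ω := by
    intro x l hx hl
    refine hrein.logDomain_mono hx ⟨?_, ?_⟩ <;> simp [he, hl]
  obtain ⟨C, hC⟩ : ∃ C, ∀ l ∈ Set.Icc 0 Λ, (∀ z ∈ logFiber {P - l • e}, φ z ≤ C) ∧
      ∀ z ∈ logFiber {Q - l • e}, φ z ≤ C := by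
    have key : ∀ R ∈ logDomain Ω, ∃ C, ∀ l ∈ Set.Icc 0 Λ, ∀ z ∈ logFiber {R - l • e}, φ z ≤ C := by
      intro R hR
      have hcpt : IsCompact ((fun l : ℝ => R - l • e) '' Set.Icc 0 Λ) :=
        isCompact_Icc.image (by fun_prop)
      have hsub : (fun l : ℝ => R - l • e) '' Set.Icc 0 Λ ⊆ logDomain Ω := by
        rintro _ ⟨l, hl, rfl⟩; exact hdown hR hl.1
      obtain ⟨C, hC⟩ := (isCompact_logFiber hcpt).bddAbove_image
        (hc.mono (hrein.logFiber_subset hsub))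
      refine ⟨C, fun l hl z hz => hC ⟨z, ⟨hz.1, hz.2.1, l, hl, ?_⟩, rfl⟩⟩
      exact hz.2.2.symm
    obtain ⟨C₁, h₁⟩ := key P hP
    obtain ⟨C₂, h₂⟩ := key Q hQ
    exact ⟨max C₁ C₂, fun l hl => ⟨fun z hz => (h₁ l hl z hz).trans (le_max_left _ _),
      fun z hz => (h₂ l hl z hz).trans (le_max_right _ _)⟩⟩
  set S : Set (ℂ × ℂ) := {z ∈ Ω | φ z ≤ C} with hS
  have hSc : IsClosed S := (hcomp C).isClosed
  set T : Set ℝ := {l ∈ Set.Icc 0 Λ | ∀ r ∈ Set.Icc (0 : ℝ) 1,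
    expPoint (P + r • (Q - P) - l • e) ∈ S} with hT
  have hTiff : ∀ l ∈ Set.Icc 0 Λ, (∀ r ∈ Set.Icc (0 : ℝ) 1,
      P + r • (Q - P) - l • e ∈ logDomain Ω) → l ∈ T := by
    intro l hl hseg
    refine ⟨hl, fun r hr => ⟨hseg r hr, ?_⟩⟩
    have hr1 : ∀ r : ℝ, P + r • (Q - P) - l • e = (P - l • e) + r • (Q - P) := by
      intro r; module
    rw [hr1]
    refine hφ.le_on_logSegment hΩ hrein hc (fun r hr => ?_) (hC l hl).1 ?_ r hr
    · rw [← hr1]; exact hseg r hr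
    · rw [show P - l • e + (Q - P) = Q - l • e by module]
      exact (hC l hl).2
  have hΛT : Λ ∈ T := by
    refine hTiff Λ ⟨hΛ0, le_rfl⟩ fun r hr => hrein.logDomain_mono hP ⟨?_, ?_⟩
    · have := le_abs_self (Q.1 - P.1)
      have h2 := abs_nonneg (Q.2 - P.2)
      have h3 : r * (Q.1 - P.1) ≤ |Q.1 - P.1| :=
        (mul_le_mul_of_nonneg_left this hr.1).trans
          (mul_le_of_le_one_left (abs_nonneg _) hr.2)
      simp only [he, Prod.fst_sub, Prod.fst_add, Prod.smul_fst, smul_eq_mul, mul_one]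
      linarith
    · have := le_abs_self (Q.2 - P.2)
      have h2 := abs_nonneg (Q.1 - P.1)
      have h3 : r * (Q.2 - P.2) ≤ |Q.2 - P.2| :=
        (mul_le_mul_of_nonneg_left this hr.1).trans
          (mul_le_of_le_one_left (abs_nonneg _) hr.2)
      simp only [he, Prod.snd_sub, Prod.snd_add, Prod.smul_snd, smul_eq_mul, mul_one]
      linarith
  have hTcl : IsClosed T := by
    have : T = Set.Icc 0 Λ ∩ ⋂ r ∈ Set.Icc (0 : ℝ) 1,
        (fun l : ℝ => expPoint (P + r • (Q - P) - l • e)) ⁻¹' S := by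
      ext l; simp [hT]
    rw [this]
    refine isClosed_Icc.inter (isClosed_biInter fun r _ => hSc.preimage ?_)
    exact continuous_expPoint.comp (by fun_prop)
  have hbdd : BddBelow T := ⟨0, fun l hl => hl.1.1⟩
  have hmem : sInf T ∈ T := hTcl.csInf_mem ⟨Λ, hΛT⟩ hbdd
  have h0T : (0 : ℝ) ∈ T := by
    rcases hmem.1.1.eq_or_lt with h0 | hpos
    · rwa [h0]
    exfalso
    have hev : ∀ᶠ l in 𝓝 (sInf T), ∀ r ∈ Set.Icc (0 : ℝ) 1,
        P + r • (Q - P) - l • e ∈ logDomain Ω := by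
      apply isCompact_Icc.eventually_forall_of_forall_eventually
      intro r hr
      have hcont : Continuous fun q : ℝ × ℝ => P + q.2 • (Q - P) - q.1 • e := by fun_prop
      exact hcont.continuousAt.eventually
        ((isOpen_logDomain hΩ).mem_nhds (hmem.2 r hr).1)
    obtain ⟨l, ⟨hl, hl0⟩, hlt⟩ := (((hev.and (eventually_gt_nhds hpos)).filter_mono
      (nhdsWithin_le_nhds (s := Set.Iio (sInf T)))).and self_mem_nhdsWithin).exists
    have hlt' : l < sInf T := hlt
    exact absurd (csInf_le hbdd (hTiff l ⟨hl0.le, (hlt'.trans_le hmem.1.2).le⟩ hl)) (not_le.2 hlt')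
  intro r hr
  have := (h0T.2 r hr).1
  rwa [zero_smul, sub_zero] at this

theorem closure_unitDisk : closure unitDisk = Metric.closedBall 0 1 :=
  closure_ball 0 one_ne_zero

theorem exists_continuousOn_log_closedBall {u : ℂ → ℂ}
    (hu : ContinuousOn u (Metric.closedBall 0 1)) (hu0 : ∀ ζ ∈ Metric.closedBall (0 : ℂ) 1, u ζ ≠ 0)
    {ζ₀ P : ℂ} (hζ₀ : ζ₀ ∈ Metric.closedBall (0 : ℂ) 1) (hP : Complex.exp P = u ζ₀) :
    ∃ h : ℂ → ℂ, ContinuousOn h (Metric.closedBall 0 1) ∧ h ζ₀ = P ∧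
      ∀ ζ ∈ Metric.closedBall (0 : ℂ) 1, Complex.exp (h ζ) = u ζ := by
  classical
  have hconv : Convex ℝ (Metric.closedBall (0 : ℂ) 1) := convex_closedBall 0 1
  have : LocallyPathConnectedSpace (Metric.closedBall (0 : ℂ) 1) :=
    hconv.locallyPathConnectedSpace
  have : ContractibleSpace (Metric.closedBall (0 : ℂ) 1) := hconv.contractibleSpace ⟨ζ₀, hζ₀⟩
  have hcov := Complex.isCoveringMapOn_exp
  obtain ⟨F, ⟨hF0, hF⟩, -⟩ := hcov.existsUnique_continuousMap_lifts
    (A := Metric.closedBall (0 : ℂ) 1)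
    ⟨(Metric.closedBall (0 : ℂ) 1).domRestrict u, continuousOn_iff_continuous_domRestrict.mp hu⟩
    (a₀ := ⟨ζ₀, hζ₀⟩) (e₀ := P) hP (fun x => hu0 x x.2)
  refine ⟨fun ζ => if hζ : ζ ∈ Metric.closedBall (0 : ℂ) 1 then F ⟨ζ, hζ⟩ else 0, ?_, ?_, ?_⟩
  · rw [continuousOn_iff_continuous_domRestrict]
    convert! map_continuous F
    ext ζ
    exact dif_pos ζ.2
  · exact (dif_pos hζ₀).trans hF0
  · intro ζ hζ
    exact (congrArg Complex.exp (dif_pos hζ)).trans (congr_fun hF ⟨ζ, hζ⟩)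

theorem differentiableOn_of_exp_comp {h u : ℂ → ℂ} {U : Set ℂ} (hU : IsOpen U)
    (hh : ContinuousOn h U) (hu : DifferentiableOn ℂ u U) (he : ∀ ζ ∈ U, Complex.exp (h ζ) = u ζ) :
    DifferentiableOn ℂ h U := by
  intro ζ hζ
  have hd := (Complex.hasStrictDerivAt_exp (h ζ))
  have hinv := hd.eventually_left_inverse (Complex.exp_ne_zero _)
  have hcont : ContinuousAt h ζ := hh.continuousAt (hU.mem_nhds hζ)
  have hev := hcont.eventually hinv
  have hud : DifferentiableAt ℂ u ζ := hu.differentiableAt (hU.mem_nhds hζ)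
  have hli := (hd.to_localInverse (Complex.exp_ne_zero _)).hasDerivAt.differentiableAt
  refine (DifferentiableAt.congr_of_eventuallyEq
    (DifferentiableAt.comp ζ (by rw [← he ζ hζ]; exact hli) hud) ?_).differentiableWithinAt
  filter_upwards [hev, hU.mem_nhds hζ] with w hw hwU
  rw [Function.comp_apply, ← he w hwU]
  exact hw.symm

/-- Componentwise exponential on `ℂ²`. -/
noncomputable def expMap (x : ℂ × ℂ) : ℂ × ℂ := (Complex.exp x.1, Complex.exp x.2)

theorem logMap_expMap (x : ℂ × ℂ) : logMap (expMap x) = (x.1.re, x.2.re) := by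
  simp [logMap, expMap, Complex.norm_exp]

/-- `(a, b)` is the normal of a line supporting `D` at `x`. -/
def IsSupportingNormal (D : Set (ℝ × ℝ)) (x : ℝ × ℝ) (a b : ℝ) : Prop :=
  ∀ y ∈ D, a * y.1 + b * y.2 < a * x.1 + b * x.2

theorem exists_isSupportingNormal {D : Set (ℝ × ℝ)} (hD : Convex ℝ D) (ho : IsOpen D) {x : ℝ × ℝ}
    (hx : x ∉ D) : ∃ a b, IsSupportingNormal D x a b := by
  obtain ⟨l, hl⟩ := geometric_hahn_banach_open_point hD ho hx
  have hlin : ∀ y : ℝ × ℝ, l y = l (1, 0) * y.1 + l (0, 1) * y.2 := by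
    intro y
    have : y = y.1 • ((1, 0) : ℝ × ℝ) + y.2 • ((0, 1) : ℝ × ℝ) := by ext <;> simp
    conv_lhs => rw [this, map_add, map_smul, map_smul]
    simp only [smul_eq_mul]; ring
  refine ⟨l (1, 0), l (0, 1), fun y hy => ?_⟩
  rw [← hlin, ← hlin]
  exact hl y hy

/-- Boundary points of a complete Reinhardt domain off the axes lie on the boundary of the
logarithmic image. -/
theorem IsCompleteReinhardt.logMap_mem_frontier {Ω : Set (ℂ × ℂ)} (h : IsCompleteReinhardt Ω)
    (hΩ : IsOpen Ω) {z : ℂ × ℂ} (hz : z ∈ frontier Ω) (h₁ : z.1 ≠ 0) (h₂ : z.2 ≠ 0) :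
    logMap z ∈ closure (logDomain Ω) ∧ logMap z ∉ logDomain Ω := by
  rw [hΩ.frontier_eq] at hz
  refine ⟨?_, fun hcon => hz.2 ((h.mem_logDomain_iff h₁ h₂).1 hcon)⟩
  have hfreq := mem_closure_iff_frequently.1 hz.1
  refine mem_closure_iff_frequently.2 ((continuousAt_logMap h₁ h₂).frequently ?_)
  refine (hfreq.and_eventually ((continuous_fst.continuousAt.eventually_ne h₁).and
    (continuous_snd.continuousAt.eventually_ne h₂))).mono ?_
  rintro w ⟨hw, hw1, hw2⟩
  exact (h.mem_logDomain_iff hw1 hw2).2 hw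

/-- An analytic disk in the boundary lies in a complex line of the logarithmic coordinates. -/
theorem exists_supportingNormal_of_disk {D : Set (ℝ × ℝ)} (hD : Convex ℝ D) (ho : IsOpen D)
    {h₁ h₂ : ℂ → ℂ} (hc₁ : ContinuousOn h₁ (Metric.closedBall 0 1))
    (hc₂ : ContinuousOn h₂ (Metric.closedBall 0 1)) (hd₁ : DifferentiableOn ℂ h₁ (Metric.ball 0 1))
    (hd₂ : DifferentiableOn ℂ h₂ (Metric.ball 0 1))
    (hcl : ∀ ζ ∈ Metric.ball (0 : ℂ) 1, ((h₁ ζ).re, (h₂ ζ).re) ∈ closure D ∧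
      ((h₁ ζ).re, (h₂ ζ).re) ∉ D)
    {ζ₀ : ℂ} (hζ₀ : ζ₀ ∈ Metric.closedBall (0 : ℂ) 1) :
    ∃ a b : ℝ, IsSupportingNormal D ((h₁ ζ₀).re, (h₂ ζ₀).re) a b ∧
      ∀ ζ ∈ Metric.closedBall (0 : ℂ) 1, a * h₁ ζ + b * h₂ ζ = a * h₁ ζ₀ + b * h₂ ζ₀ := by
  have h0 : (0 : ℂ) ∈ Metric.ball (0 : ℂ) 1 := by simp
  obtain ⟨a, b, hab⟩ := exists_isSupportingNormal hD ho (hcl 0 h0).2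
  set H : ℂ → ℂ := fun ζ => a * h₁ ζ + b * h₂ ζ with hH
  have hHc : ContinuousOn H (Metric.closedBall 0 1) :=
    (continuousOn_const.mul hc₁).add (continuousOn_const.mul hc₂)
  have hHd : DifferentiableOn ℂ H (Metric.ball 0 1) :=
    ((differentiableOn_const _).mul hd₁).add ((differentiableOn_const _).mul hd₂)
  have hre : ∀ ζ, (H ζ).re = a * (h₁ ζ).re + b * (h₂ ζ).re := by
    intro ζ; simp [hH]
  have hle : ∀ ζ ∈ Metric.ball (0 : ℂ) 1, (H ζ).re ≤ (H 0).re := by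
    intro ζ hζ
    rw [hre, hre]
    have hsub : D ⊆ {y | a * y.1 + b * y.2 ≤ a * (h₁ 0).re + b * (h₂ 0).re} :=
      fun y hy => (hab y hy).le
    have hcl' : IsClosed {y : ℝ × ℝ | a * y.1 + b * y.2 ≤ a * (h₁ 0).re + b * (h₂ 0).re} :=
      isClosed_le (by fun_prop) continuous_const
    exact closure_minimal hsub hcl' (hcl ζ hζ).1
  have hexp : Set.EqOn (fun ζ => Complex.exp (H ζ)) (Function.const ℂ (Complex.exp (H 0)))
      (Metric.ball 0 1) := by
    refine Complex.eqOn_of_isPreconnected_of_isMaxOn_norm (convex_ball 0 1).isPreconnected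
      Metric.isOpen_ball hHd.cexp h0 ?_
    intro ζ hζ
    simp only [Function.comp_apply, Set.mem_ofPred_eq, Complex.norm_exp]
    exact Real.exp_le_exp.2 (hle ζ hζ)
  have hconst : ∀ ζ ∈ Metric.ball (0 : ℂ) 1, H ζ = H 0 := by
    intro ζ hζ
    refine Metric.isOpen_ball.is_const_of_deriv_eq_zero (convex_ball 0 1).isPreconnected hHd
      (fun w hw => ?_) hζ h0
    have hda := (hHd.differentiableAt (Metric.isOpen_ball.mem_nhds hw)).hasDerivAt
    have h1 := hda.cexp
    have h2 : HasDerivAt (fun ζ => Complex.exp (H ζ)) 0 w := by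
      refine (hasDerivAt_const w (Complex.exp (H 0))).congr_of_eventuallyEq ?_
      filter_upwards [Metric.isOpen_ball.mem_nhds hw] with v hv using hexp hv
    exact (mul_eq_zero.1 (h1.unique h2)).resolve_left (Complex.exp_ne_zero _)
  have hconst' : ∀ ζ ∈ Metric.closedBall (0 : ℂ) 1, H ζ = H 0 := by
    have : Set.EqOn H (fun _ => H 0) (Metric.closedBall 0 1) := by
      refine Set.EqOn.of_subset_closure (s := Metric.ball 0 1) hconst hHc continuousOn_const
        Metric.ball_subset_closedBall ?_
      rw [closure_ball 0 one_ne_zero]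
    exact this
  refine ⟨a, b, fun y hy => ?_, fun ζ hζ => (hconst' ζ hζ).trans (hconst' ζ₀ hζ₀).symm⟩
  have := hab y hy
  have e := congrArg Complex.re (hconst' ζ₀ hζ₀)
  rw [hre, hre] at e
  simp only at this ⊢
  linarith

theorem LinearMap.eq_smul_of_neg_imp_neg {E : Type*} [AddCommGroup E] [Module ℝ E]
    {R l : E →ₗ[ℝ] ℝ} {V : E} (hV : R V = -1) (h : ∀ v, R v < 0 → l v < 0) :
    l = (-l V) • R := by
  have hker : ∀ v, R v = 0 → l v = 0 := by
    intro v hv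
    by_contra hne
    have := h (V + (-l V / l v) • v) (by simp [hV, hv])
    rw [map_add, map_smul, smul_eq_mul, div_mul_cancel₀ _ hne] at this
    linarith
  ext v
  have := hker (v + R v • V) (by simp [hV])
  rw [map_add, map_smul, smul_eq_mul] at this
  simp only [LinearMap.smul_apply, smul_eq_mul]
  linarith

/-- At a smooth boundary point off the axes the supporting line of the logarithmic image is
unique. -/
theorem HasSmoothBoundary.supportingNormal_unique {Ω : Set (ℂ × ℂ)} (hs : HasSmoothBoundary Ω)
    (hrein : IsCompleteReinhardt Ω) {P : ℂ × ℂ} (hP : expMap P ∈ frontier Ω)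
    {a b a' b' : ℝ} (hab : IsSupportingNormal (logDomain Ω) (P.1.re, P.2.re) a b)
    (hab' : IsSupportingNormal (logDomain Ω) (P.1.re, P.2.re) a' b') :
    (a ≠ 0 ∨ b ≠ 0) ∧ ∃ c : ℝ, c ≠ 0 ∧ a' = c * a ∧ b' = c * b := by
  obtain ⟨U, r, hU, hpU, hr, hdr, hUr⟩ := hs _ hP
  set p := expMap P with hp
  have hrd : DifferentiableAt ℝ r p :=
    (hr.contDiffAt (hU.mem_nhds hpU)).differentiableAt (by simp)
  have hrp : r p ≤ 0 := by
    have hpc : p ∈ closure (Ω ∩ U) := by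
      rw [mem_closure_iff_frequently]
      exact (mem_closure_iff_frequently.1 (frontier_subset_closure hP)).and_eventually
        (hU.mem_nhds hpU)
    rw [mem_closure_iff_frequently] at hpc
    by_contra! hcon
    obtain ⟨w, hw1, hw2⟩ := (hpc.and_eventually
      (hrd.continuousAt.eventually_const_lt hcon)).exists
    rw [hUr] at hw1
    exact lt_asymm hw1.2 hw2
  set R : ℂ × ℂ →ₗ[ℝ] ℝ :=
    { toFun := fun V => fderiv ℝ r p (p.1 * V.1, p.2 * V.2)
      map_add' := fun V W => by rw [← map_add]; congr 1; ext <;> simp [mul_add]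
      map_smul' := fun t V => by
        rw [RingHom.id_apply, ← map_smul]; congr 1
        ext1 <;> simp only [Prod.smul_fst, Prod.smul_snd, mul_smul_comm] } with hR
  have hp₁ : p.1 ≠ 0 := Complex.exp_ne_zero _
  have hp₂ : p.2 ≠ 0 := Complex.exp_ne_zero _
  have hneg : ∀ V : ℂ × ℂ, R V < 0 → ∃ t : ℝ, 0 < t ∧
      (P.1.re + t * V.1.re, P.2.re + t * V.2.re) ∈ logDomain Ω := by
    intro V hV
    set γ : ℝ → ℂ × ℂ := fun t => expMap (P + t • V) with hγ
    have hγd : HasDerivAt γ (p.1 * V.1, p.2 * V.2) 0 := by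
      have e : ∀ u v : ℂ, HasDerivAt (fun t : ℝ => Complex.exp (u + t • v)) (Complex.exp u * v) 0 := by
        intro u v
        have h1 : HasDerivAt (fun t : ℝ => u + t • v) v 0 := by
          simpa using ((hasDerivAt_id (0 : ℝ)).smul_const v).const_add u
        simpa using h1.cexp
      exact (e P.1 V.1).prodMk (e P.2 V.2)
    have hγ0 : γ 0 = p := by simp [hγ, hp]
    have hrγ : HasDerivAt (r ∘ γ) (R V) 0 := by
      have : HasFDerivAt r (fderiv ℝ r p) (γ 0) := by rw [hγ0]; exact hrd.hasFDerivAt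
      exact this.comp_hasDerivAt 0 hγd
    have hlt : ∀ᶠ t in 𝓝[>] (0 : ℝ), (r ∘ γ) t < 0 := by
      have hsl := (hasDerivAt_iff_tendsto_slope.1 hrγ).mono_left
        (nhdsWithin_mono 0 (fun t (ht : 0 < t) => ht.ne'))
      filter_upwards [hsl.eventually_lt_const hV, self_mem_nhdsWithin] with t ht ht0
      replace ht0 : 0 < t := ht0
      rw [slope_def_field, sub_zero, div_lt_iff₀ ht0, zero_mul, Function.comp_apply,
        Function.comp_apply, hγ0] at ht
      rw [Function.comp_apply]
      linarith
    have hUe : ∀ᶠ t in 𝓝[>] (0 : ℝ), γ t ∈ U :=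
      (hγd.continuousAt.eventually (by rw [hγ0]; exact hU.mem_nhds hpU)).filter_mono
        nhdsWithin_le_nhds
    obtain ⟨t, ⟨ht1, ht2⟩, ht0⟩ := ((hlt.and hUe).and self_mem_nhdsWithin).exists
    refine ⟨t, ht0, ?_⟩
    have hmem : γ t ∈ Ω ∩ U := by rw [hUr]; exact ⟨ht2, ht1⟩
    have := (hrein.mem_logDomain_iff (Complex.exp_ne_zero _) (Complex.exp_ne_zero _)).2 hmem.1
    rw [logMap_expMap] at this
    simpa using this
  obtain ⟨V, hV⟩ : ∃ V, R V = -1 := by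
    obtain ⟨v, hv⟩ : ∃ v, fderiv ℝ r p v ≠ 0 := by
      by_contra! hcon
      exact hdr (ContinuousLinearMap.ext hcon)
    have hRv : R (v.1 / p.1, v.2 / p.2) = fderiv ℝ r p v := by
      simp only [hR, LinearMap.coe_mk, AddHom.coe_mk, mul_div_cancel₀ _ hp₁, mul_div_cancel₀ _ hp₂]
    refine ⟨(-(fderiv ℝ r p v)⁻¹) • (v.1 / p.1, v.2 / p.2), ?_⟩
    rw [map_smul, hRv, smul_eq_mul, neg_mul, inv_mul_cancel₀ hv]
  have key : ∀ a b, IsSupportingNormal (logDomain Ω) (P.1.re, P.2.re) a b →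
      ∃ c : ℝ, c ≠ 0 ∧ a = c * R (1, 0) ∧ b = c * R (0, 1) := by
    intro a b hab
    set l : ℂ × ℂ →ₗ[ℝ] ℝ := a • (Complex.reLm ∘ₗ LinearMap.fst ℝ ℂ ℂ) +
      b • (Complex.reLm ∘ₗ LinearMap.snd ℝ ℂ ℂ) with hl
    have hlv : ∀ v, l v = a * v.1.re + b * v.2.re := by intro v; simp [hl]
    have himp : ∀ v, R v < 0 → l v < 0 := by
      intro v hv
      obtain ⟨t, ht, hmem⟩ := hneg v hv
      have := hab _ hmem
      simp only at this
      rw [hlv]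
      by_contra! hcon
      nlinarith [mul_nonneg ht.le hcon]
    have heq := LinearMap.eq_smul_of_neg_imp_neg hV himp
    refine ⟨-l V, ?_, ?_, ?_⟩
    · have := himp V (by rw [hV]; norm_num)
      linarith
    · have := LinearMap.congr_fun heq (1, 0)
      simpa [hlv] using this
    · have := LinearMap.congr_fun heq (0, 1)
      simpa [hlv] using this
  obtain ⟨c, hc, ha, hb⟩ := key a b hab
  obtain ⟨c', hc', ha', hb'⟩ := key a' b' hab'
  refine ⟨?_, c' / c, div_ne_zero hc' hc, ?_, ?_⟩
  · by_contra! hcon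
    obtain ⟨t, -, hmem⟩ := hneg V (by rw [hV]; norm_num)
    have := hab _ hmem
    simp [hcon.1, hcon.2] at this
  · rw [ha', ha]; field_simp
  · rw [hb', hb]; field_simp

theorem exists_complexLine (x : ℂ × ℂ) {α β : ℂ} (h : α ≠ 0 ∨ β ≠ 0) :
    ∃ L : AffineSubspace ℂ (ℂ × ℂ), IsComplexLine L ∧
      ∀ y : ℂ × ℂ, α * y.1 + β * y.2 = α * x.1 + β * x.2 → y ∈ L := by
  have hv : ((-β, α) : ℂ × ℂ) ≠ 0 := by
    intro h0
    simp only [Prod.mk_eq_zero, neg_eq_zero] at h0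
    tauto
  refine ⟨AffineSubspace.mk' x (Submodule.span ℂ {(-β, α)}), ?_, fun y hy => ?_⟩
  · rw [IsComplexLine, AffineSubspace.direction_mk']
    exact finrank_span_singleton hv
  · rw [AffineSubspace.mem_mk', Submodule.mem_span_singleton]
    rcases h with h | h
    · refine ⟨(y.2 - x.2) / α, ?_⟩
      ext <;> simp <;> field_simp
      linear_combination -hy
    · refine ⟨-(y.1 - x.1) / β, ?_⟩
      ext <;> simp <;> field_simp
      · ring
      · linear_combination -hy

theorem IsComplexLine.eq_of_mem_of_mem {L L' : AffineSubspace ℂ (ℂ × ℂ)} (hL : IsComplexLine L)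
    (hL' : IsComplexLine L') {p q : ℂ × ℂ} (hpq : p ≠ q) (hp : p ∈ L) (hq : q ∈ L) (hp' : p ∈ L')
    (hq' : q ∈ L') : L' = L := by
  have key : ∀ M : AffineSubspace ℂ (ℂ × ℂ), IsComplexLine M → p ∈ M → q ∈ M →
      Submodule.span ℂ {q - p} = M.direction := by
    intro M hM hpM hqM
    apply Submodule.eq_of_le_of_finrank_eq
    · rw [Submodule.span_singleton_le_iff_mem]
      exact AffineSubspace.vsub_mem_direction hqM hpM
    · rw [finrank_span_singleton (sub_ne_zero.2 hpq.symm)]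
      exact hM.symm
  exact AffineSubspace.ext_of_direction_eq ((key L' hL' hp' hq').symm.trans (key L hL hp hq))
    ⟨p, hp', hp⟩

/-- The monomial automorphism of `(ℂ \ {0})²` attached to an integer matrix of determinant one. -/
theorem exists_monomial_biholomorphism {u v m n : ℤ} (h : u * m + v * n = 1) :
    ∃ T : OpenPartialHomeomorph (ℂ × ℂ) (ℂ × ℂ), IsBiholomorphism T ∧
      T.source = {z | z.1 ≠ 0 ∧ z.2 ≠ 0} ∧ ∀ z, (T z).2 = z.1 ^ m * z.2 ^ n := by
  have hopen : IsOpen {z : ℂ × ℂ | z.1 ≠ 0 ∧ z.2 ≠ 0} :=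
    (isOpen_ne.preimage continuous_fst).inter (isOpen_ne.preimage continuous_snd)
  have hd : ∀ a b c d : ℤ, DifferentiableOn ℂ
      (fun z : ℂ × ℂ => (z.1 ^ a * z.2 ^ b, z.1 ^ c * z.2 ^ d)) {z | z.1 ≠ 0 ∧ z.2 ≠ 0} := by
    intro a b c d z hz
    have h1 : ∀ k : ℤ, DifferentiableAt ℂ (fun z : ℂ × ℂ => z.1 ^ k) z := fun k =>
      differentiableAt_fst.zpow (Or.inl hz.1)
    have h2 : ∀ k : ℤ, DifferentiableAt ℂ (fun z : ℂ × ℂ => z.2 ^ k) z := fun k =>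
      differentiableAt_snd.zpow (Or.inl hz.2)
    exact (((h1 a).mul (h2 b)).prodMk ((h1 c).mul (h2 d))).differentiableWithinAt
  have hinv : ∀ {z : ℂ × ℂ} {a b c d a' b' c' d' : ℤ}, z.1 ≠ 0 → z.2 ≠ 0 →
      a' * a + b' * c = 1 → a' * b + b' * d = 0 → c' * a + d' * c = 0 → c' * b + d' * d = 1 →
      ((z.1 ^ a * z.2 ^ b) ^ a' * (z.1 ^ c * z.2 ^ d) ^ b',
        (z.1 ^ a * z.2 ^ b) ^ c' * (z.1 ^ c * z.2 ^ d) ^ d') = z := by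
    intro z a b c d a' b' c' d' h1 h2 e1 e2 e3 e4
    have e : ∀ i j : ℤ, (z.1 ^ a * z.2 ^ b) ^ i * (z.1 ^ c * z.2 ^ d) ^ j
        = z.1 ^ (i * a + j * c) * z.2 ^ (i * b + j * d) := by
      intro i j
      rw [mul_zpow, mul_zpow, ← zpow_mul, ← zpow_mul, ← zpow_mul, ← zpow_mul, zpow_add₀ h1,
        zpow_add₀ h2, mul_comm a, mul_comm b, mul_comm c, mul_comm d]
      ring
    rw [e, e, e1, e2, e3, e4]
    simp
  refine ⟨{
    toFun := fun z => (z.1 ^ v * z.2 ^ (-u), z.1 ^ m * z.2 ^ n)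
    invFun := fun z => (z.1 ^ n * z.2 ^ u, z.1 ^ (-m) * z.2 ^ v)
    source := {z | z.1 ≠ 0 ∧ z.2 ≠ 0}
    target := {z | z.1 ≠ 0 ∧ z.2 ≠ 0}
    map_source' := fun z hz => ⟨mul_ne_zero (zpow_ne_zero _ hz.1) (zpow_ne_zero _ hz.2),
      mul_ne_zero (zpow_ne_zero _ hz.1) (zpow_ne_zero _ hz.2)⟩
    map_target' := fun z hz => ⟨mul_ne_zero (zpow_ne_zero _ hz.1) (zpow_ne_zero _ hz.2),
      mul_ne_zero (zpow_ne_zero _ hz.1) (zpow_ne_zero _ hz.2)⟩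
    left_inv' := fun z hz => hinv hz.1 hz.2 (by linarith) (by ring) (by ring) (by linarith)
    right_inv' := fun z hz => hinv hz.1 hz.2 (by linarith) (by ring) (by ring) (by linarith)
    open_source := hopen
    open_target := hopen
    continuousOn_toFun := (hd _ _ _ _).continuousOn
    continuousOn_invFun := (hd _ _ _ _).continuousOn }, ⟨hd _ _ _ _, hd _ _ _ _⟩, rfl,
    fun _ => rfl⟩

theorem isOpenMap_expMap : IsOpenMap expMap :=
  Complex.isOpenMap_exp.prodMap Complex.isOpenMap_exp

theorem hasStrictFDerivAt_expMap (x : ℂ × ℂ) :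
    ∃ E : (ℂ × ℂ) ≃L[ℂ] ℂ × ℂ, HasStrictFDerivAt expMap (E : ℂ × ℂ →L[ℂ] ℂ × ℂ) x := by
  refine ⟨(ContinuousLinearEquiv.unitsEquivAut ℂ (Units.mk0 _ (Complex.exp_ne_zero x.1))).prodCongr
    (ContinuousLinearEquiv.unitsEquivAut ℂ (Units.mk0 _ (Complex.exp_ne_zero x.2))), ?_⟩
  have h1 := (Complex.hasStrictDerivAt_exp x.1).hasStrictFDerivAt.comp x
    (hasStrictFDerivAt_fst (𝕜 := ℂ) (E := ℂ) (F := ℂ))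
  have h2 := (Complex.hasStrictDerivAt_exp x.2).hasStrictFDerivAt.comp x
    (hasStrictFDerivAt_snd (𝕜 := ℂ) (E := ℂ) (F := ℂ))
  have key : ((((ContinuousLinearEquiv.unitsEquivAut ℂ
      (Units.mk0 _ (Complex.exp_ne_zero x.1))).prodCongr (ContinuousLinearEquiv.unitsEquivAut ℂ
        (Units.mk0 _ (Complex.exp_ne_zero x.2))) : (ℂ × ℂ) ≃L[ℂ] ℂ × ℂ)) : ℂ × ℂ →L[ℂ] ℂ × ℂ) =
      (ContinuousLinearMap.toSpanSingleton ℂ (Complex.exp x.1) ∘SL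
        ContinuousLinearMap.fst ℂ ℂ ℂ).prod
      (ContinuousLinearMap.toSpanSingleton ℂ (Complex.exp x.2) ∘SL
        ContinuousLinearMap.snd ℂ ℂ ℂ) := by
    ext <;> simp
  rw [key]
  exact h1.prodMk h2

/-- Near a compact set on which it is injective, the componentwise exponential has a biholomorphic
inverse. -/
theorem exists_log_biholomorphism {K : Set (ℂ × ℂ)} (hK : IsCompact K) (hinj : Set.InjOn expMap K) :
    ∃ T : OpenPartialHomeomorph (ℂ × ℂ) (ℂ × ℂ), IsBiholomorphism T ∧
      ∀ x ∈ K, expMap x ∈ T.source ∧ T (expMap x) = x := by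
  choose E hE using hasStrictFDerivAt_expMap
  obtain ⟨V, hV, hKV, hVinj⟩ := hinj.exists_isOpen_superset hK
    (fun x _ => (hE x).hasFDerivAt.continuousAt) (fun x _ =>
      ⟨_, ((hE x).toOpenPartialHomeomorph expMap).open_source.mem_nhds
        (hE x).mem_toOpenPartialHomeomorph_source,
        ((hE x).toOpenPartialHomeomorph expMap).injOn⟩)
  have hdiff : Differentiable ℂ expMap := fun x => (hE x).hasFDerivAt.differentiableAt
  let e : OpenPartialHomeomorph (ℂ × ℂ) (ℂ × ℂ) :=
    OpenPartialHomeomorph.ofContinuousOpen (hVinj.toPartialEquiv expMap V)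
      hdiff.continuous.continuousOn isOpenMap_expMap hV
  refine ⟨e.symm, ⟨fun y hy => ?_, hdiff.differentiableOn⟩, fun x hx => ?_⟩
  · exact (e.hasFDerivAt_symm hy (hE _).hasFDerivAt).differentiableAt.differentiableWithinAt
  · exact ⟨e.map_source (hKV hx), e.left_inv (hKV hx)⟩

/-- A compact piece of a line with real coefficients in logarithmic coordinates is straightened by
a biholomorphism. -/
theorem exists_straightening {K : Set (ℂ × ℂ)} (hK : IsCompact K) {a b : ℝ} (hab : a ≠ 0 ∨ b ≠ 0)
    {x₀ : ℂ × ℂ} (hline : ∀ x ∈ K, a * x.1 + b * x.2 = a * x₀.1 + b * x₀.2) :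
    ∃ (T : OpenPartialHomeomorph (ℂ × ℂ) (ℂ × ℂ)) (L : AffineSubspace ℂ (ℂ × ℂ)),
      IsBiholomorphism T ∧ IsComplexLine L ∧ ∀ x ∈ K, expMap x ∈ T.source ∧ T (expMap x) ∈ L := by
  by_cases hrat : ∃ m n : ℤ, (m ≠ 0 ∨ n ≠ 0) ∧ a * n = b * m
  · obtain ⟨M, N, hMN, hMNab⟩ := hrat
    have hg : (Int.gcd M N : ℤ) ≠ 0 := by
      rw [Int.natCast_ne_zero, Ne, Int.gcd_eq_zero_iff]
      tauto
    obtain ⟨m, hm⟩ := Int.gcd_dvd_left M N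
    obtain ⟨n, hn⟩ := Int.gcd_dvd_right M N
    have hbez := Int.gcd_eq_gcd_ab M N
    set u := Int.gcdA M N
    set v := Int.gcdB M N
    set g : ℤ := (Int.gcd M N : ℤ) with hgdef
    have huv : u * m + v * n = 1 := by
      apply mul_left_cancel₀ hg
      linear_combination -hbez - u * hm - v * hn
    have hR : (u : ℝ) * m + v * n = 1 := by exact_mod_cast huv
    have hmn : a * n = b * m := by
      have hgR : (g : ℝ) ≠ 0 := by exact_mod_cast hg
      have hm' : (M : ℝ) = g * m := by exact_mod_cast hm
      have hn' : (N : ℝ) = g * n := by exact_mod_cast hn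
      apply mul_left_cancel₀ hgR
      rw [hm', hn'] at hMNab
      linear_combination hMNab
    set t : ℝ := a * u + b * v with ht
    have hta : t * m = a := by linear_combination a * hR - v * hmn
    have htb : t * n = b := by linear_combination b * hR + u * hmn
    have ht0 : t ≠ 0 := by
      rintro h0
      rw [h0, zero_mul] at hta htb
      rcases hab with h | h
      · exact h hta.symm
      · exact h htb.symm
    obtain ⟨T, hT, hTs, hT2⟩ := exists_monomial_biholomorphism huv
    obtain ⟨L, hL, hLmem⟩ := exists_complexLine (0, Complex.exp (m * x₀.1 + n * x₀.2))
      (α := 0) (β := 1) (Or.inr one_ne_zero)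
    refine ⟨T, L, hT, hL, fun x hx => ⟨?_, hLmem _ ?_⟩⟩
    · rw [hTs]; exact ⟨Complex.exp_ne_zero _, Complex.exp_ne_zero _⟩
    · have hx' := hline x hx
      have hmx : (m : ℂ) * x.1 + n * x.2 = m * x₀.1 + n * x₀.2 := by
        have htC : (t : ℂ) ≠ 0 := by exact_mod_cast ht0
        have hta' : (a : ℂ) = t * m := by exact_mod_cast hta.symm
        have htb' : (b : ℂ) = t * n := by exact_mod_cast htb.symm
        apply mul_left_cancel₀ htC
        rw [hta', htb'] at hx'
        linear_combination hx'
      simp only [zero_mul, zero_add, one_mul, hT2, expMap]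
      rw [← Complex.exp_int_mul, ← Complex.exp_int_mul, ← Complex.exp_add, hmx]
  · have hinj : Set.InjOn expMap K := by
      intro x hx y hy hxy
      obtain ⟨m, hm⟩ := Complex.exp_eq_exp_iff_exists_int.1 (congrArg Prod.fst hxy)
      obtain ⟨n, hn⟩ := Complex.exp_eq_exp_iff_exists_int.1 (congrArg Prod.snd hxy)
      have hxy' := (hline x hx).trans (hline y hy).symm
      have hI : (2 * Real.pi * I : ℂ) ≠ 0 := Complex.two_pi_I_ne_zero
      have h0 : (a : ℂ) * m + b * n = 0 := by
        apply mul_right_cancel₀ hI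
        rw [hm, hn] at hxy'
        linear_combination hxy'
      have h0R : a * m + b * n = 0 := by exact_mod_cast h0
      have hz : ¬((-n : ℤ) ≠ 0 ∨ m ≠ 0) := by
        intro hne
        refine hrat ⟨-n, m, hne, ?_⟩
        push_cast
        linarith
      push Not at hz
      have hn0 : n = 0 := by simpa using hz.1
      rw [hz.2] at hm
      rw [hn0] at hn
      ext1
      · simpa using hm
      · simpa using hn
    obtain ⟨T, hT, hTK⟩ := exists_log_biholomorphism hK hinj
    obtain ⟨L, hL, hLmem⟩ := exists_complexLine x₀ (α := (a : ℂ)) (β := b)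
      (by simpa using hab)
    refine ⟨T, L, hT, hL, fun x hx => ⟨(hTK x hx).1, ?_⟩⟩
    rw [(hTK x hx).2]
    exact hLmem x (hline x hx)

theorem closure_image_unitDisk {f : ℂ → ℂ × ℂ} (hf : DiffContOnCl ℂ f unitDisk) :
    closure (f '' unitDisk) = f '' Metric.closedBall 0 1 := by
  have hc : ContinuousOn f (Metric.closedBall 0 1) := closure_unitDisk ▸ hf.continuousOn
  apply subset_antisymm
  · exact closure_minimal (Set.image_mono Metric.ball_subset_closedBall)
      ((isCompact_closedBall (0 : ℂ) 1).image_of_continuousOn hc).isClosed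
  · rw [← closure_unitDisk]
    exact hf.continuousOn.image_closure

theorem DiffContOnCl.exists_lift_expMap {f : ℂ → ℂ × ℂ} (hf : DiffContOnCl ℂ f unitDisk)
    (hax : closure (f '' unitDisk) ∩ coordinateAxes = ∅) {ζ₀ : ℂ}
    (hζ₀ : ζ₀ ∈ Metric.closedBall (0 : ℂ) 1) {P : ℂ × ℂ} (hP : expMap P = f ζ₀) :
    ∃ h₁ h₂ : ℂ → ℂ, ContinuousOn h₁ (Metric.closedBall 0 1) ∧
      ContinuousOn h₂ (Metric.closedBall 0 1) ∧ DifferentiableOn ℂ h₁ (Metric.ball 0 1) ∧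
      DifferentiableOn ℂ h₂ (Metric.ball 0 1) ∧ h₁ ζ₀ = P.1 ∧ h₂ ζ₀ = P.2 ∧
      ∀ ζ ∈ Metric.closedBall (0 : ℂ) 1, expMap (h₁ ζ, h₂ ζ) = f ζ := by
  have hc : ContinuousOn f (Metric.closedBall 0 1) := closure_unitDisk ▸ hf.continuousOn
  have hne : ∀ ζ ∈ Metric.closedBall (0 : ℂ) 1, f ζ ∉ coordinateAxes := by
    intro ζ hζ hcon
    have : f ζ ∈ closure (f '' unitDisk) ∩ coordinateAxes :=
      ⟨by rw [closure_image_unitDisk hf]; exact ⟨ζ, hζ, rfl⟩, hcon⟩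
    rw [hax] at this
    exact this
  obtain ⟨h₁, hc₁, h₁0, he₁⟩ := exists_continuousOn_log_closedBall (u := fun ζ => (f ζ).1)
    (continuous_fst.comp_continuousOn hc) (fun ζ hζ h0 => hne ζ hζ (Or.inl h0)) hζ₀
    (congrArg Prod.fst hP)
  obtain ⟨h₂, hc₂, h₂0, he₂⟩ := exists_continuousOn_log_closedBall (u := fun ζ => (f ζ).2)
    (continuous_snd.comp_continuousOn hc) (fun ζ hζ h0 => hne ζ hζ (Or.inr h0)) hζ₀
    (congrArg Prod.snd hP)
  have hsub := Metric.ball_subset_closedBall (x := (0 : ℂ)) (ε := 1)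
  refine ⟨h₁, h₂, hc₁, hc₂, ?_, ?_, h₁0, h₂0, fun ζ hζ => Prod.ext (he₁ ζ hζ) (he₂ ζ hζ)⟩
  · exact differentiableOn_of_exp_comp Metric.isOpen_ball (hc₁.mono hsub)
      hf.differentiableOn.fst fun ζ hζ => he₁ ζ (hsub hζ)
  · exact differentiableOn_of_exp_comp Metric.isOpen_ball (hc₂.mono hsub)
      hf.differentiableOn.snd fun ζ hζ => he₂ ζ (hsub hζ)

theorem IsBiholomorphism.isAnalyticDisk_image {T : OpenPartialHomeomorph (ℂ × ℂ) (ℂ × ℂ)}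
    (hT : IsBiholomorphism T) {f : ℂ → ℂ × ℂ} (hf : DiffContOnCl ℂ f unitDisk)
    (hsub : closure (f '' unitDisk) ⊆ T.source) : IsAnalyticDisk (T '' (f '' unitDisk)) := by
  refine ⟨T ∘ f, ⟨hT.1.comp hf.differentiableOn fun ζ hζ => hsub (subset_closure ⟨ζ, hζ, rfl⟩),
    T.continuousOn.comp hf.continuousOn fun ζ hζ => hsub ?_⟩, Set.image_comp _ _ _⟩
  exact hf.continuousOn.image_closure ⟨ζ, hζ, rfl⟩

theorem complexLine_unique_of_nontrivial {T : OpenPartialHomeomorph (ℂ × ℂ) (ℂ × ℂ)}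
    {A : Set (ℂ × ℂ)} (hA : A ⊆ T.source) {L : AffineSubspace ℂ (ℂ × ℂ)} (hL : IsComplexLine L)
    (hTL : T '' A ⊆ (L : Set (ℂ × ℂ))) (hne : A.Nontrivial) (L' : AffineSubspace ℂ (ℂ × ℂ))
    (hL' : IsComplexLine L') (hTL' : T '' A ⊆ (L' : Set (ℂ × ℂ))) : L' = L := by
  obtain ⟨p, hp, q, hq, hpq⟩ := hne
  exact hL.eq_of_mem_of_mem hL' (fun h => hpq (T.injOn (hA hp) (hA hq) h)) (hTL ⟨p, hp, rfl⟩)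
    (hTL ⟨q, hq, rfl⟩) (hTL' ⟨p, hp, rfl⟩) (hTL' ⟨q, hq, rfl⟩)

theorem mainTheorem4 (Ω : Set (ℂ × ℂ)) (hdom : IsDomainSet Ω) (hbdd : Bornology.IsBounded Ω)
    (hpsc : IsPseudoconvex Ω) (hrein : IsCompleteReinhardt Ω) (hsmooth : HasSmoothBoundary Ω)
    (f g : ℂ → ℂ × ℂ)
    (hf : DiffContOnCl ℂ f unitDisk) (hg : DiffContOnCl ℂ g unitDisk)
    (hfΩ : Set.MapsTo f unitDisk (frontier Ω)) (hgΩ : Set.MapsTo g unitDisk (frontier Ω))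
    (hfg : (closure (f '' unitDisk) ∩ closure (g '' unitDisk)).Nonempty)
    (hfax : closure (f '' unitDisk) ∩ coordinateAxes = ∅)
    (hgax : closure (g '' unitDisk) ∩ coordinateAxes = ∅) :
    ∃ (T : OpenPartialHomeomorph (ℂ × ℂ) (ℂ × ℂ)) (L : AffineSubspace ℂ (ℂ × ℂ)),
      IsBiholomorphism T ∧
      closure (f '' unitDisk) ∪ closure (g '' unitDisk) ⊆ T.source ∧
      IsComplexLine L ∧
      (IsAnalyticDisk (T '' (f '' unitDisk)) ∧ T '' (f '' unitDisk) ⊆ (L : Set (ℂ × ℂ))) ∧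
      (IsAnalyticDisk (T '' (g '' unitDisk)) ∧ T '' (g '' unitDisk) ⊆ (L : Set (ℂ × ℂ))) ∧
      ((f '' unitDisk).Nontrivial → ∀ L' : AffineSubspace ℂ (ℂ × ℂ), IsComplexLine L' →
        T '' (f '' unitDisk) ⊆ (L' : Set (ℂ × ℂ)) → L' = L) ∧
      ((g '' unitDisk).Nontrivial → ∀ L' : AffineSubspace ℂ (ℂ × ℂ), IsComplexLine L' →
        T '' (g '' unitDisk) ⊆ (L' : Set (ℂ × ℂ)) → L' = L) := by
  obtain ⟨p, hpf, hpg⟩ := hfg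
  have hp_ax : p ∉ coordinateAxes := fun h => by
    have : p ∈ closure (f '' unitDisk) ∩ coordinateAxes := ⟨hpf, h⟩
    rw [hfax] at this
    exact this
  have hpΩ : p ∈ frontier Ω :=
    closure_minimal (Set.image_subset_iff.2 hfΩ) isClosed_frontier hpf
  have hclf := closure_image_unitDisk hf
  have hclg := closure_image_unitDisk hg
  obtain ⟨ζf, hζf, hfp⟩ := hclf ▸ hpf
  obtain ⟨ζg, hζg, hgp⟩ := hclg ▸ hpg
  set P : ℂ × ℂ := (Complex.log p.1, Complex.log p.2) with hPdef
  have hP : expMap P = p := by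
    ext1
    · exact Complex.exp_log fun h => hp_ax (Or.inl h)
    · exact Complex.exp_log fun h => hp_ax (Or.inr h)
  obtain ⟨h₁, h₂, hc₁, hc₂, hd₁, hd₂, e₁, e₂, he⟩ :=
    hf.exists_lift_expMap hfax hζf (hP.trans hfp.symm)
  obtain ⟨k₁, k₂, hkc₁, hkc₂, hkd₁, hkd₂, ke₁, ke₂, hke⟩ :=
    hg.exists_lift_expMap hgax hζg (hP.trans hgp.symm)
  have hconv := hpsc.convex_logDomain hdom.1 hrein
  have hopen := isOpen_logDomain hdom.1
  have hbd : ∀ x : ℂ × ℂ, expMap x ∈ frontier Ω →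
      (x.1.re, x.2.re) ∈ closure (logDomain Ω) ∧ (x.1.re, x.2.re) ∉ logDomain Ω := by
    intro x hx
    rw [← logMap_expMap]
    exact hrein.logMap_mem_frontier hdom.1 hx (Complex.exp_ne_zero _) (Complex.exp_ne_zero _)
  have hsub := Metric.ball_subset_closedBall (x := (0 : ℂ)) (ε := 1)
  obtain ⟨a, b, hab, hline⟩ := exists_supportingNormal_of_disk hconv hopen hc₁ hc₂ hd₁ hd₂
    (fun ζ hζ => hbd (h₁ ζ, h₂ ζ) (by rw [he ζ (hsub hζ)]; exact hfΩ hζ)) hζf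
  obtain ⟨a', b', hab', hline'⟩ := exists_supportingNormal_of_disk hconv hopen hkc₁ hkc₂ hkd₁ hkd₂
    (fun ζ hζ => hbd (k₁ ζ, k₂ ζ) (by rw [hke ζ (hsub hζ)]; exact hgΩ hζ)) hζg
  rw [e₁, e₂] at hab hline
  rw [ke₁, ke₂] at hab' hline'
  obtain ⟨hne, c, hc, rfl, rfl⟩ :=
    hsmooth.supportingNormal_unique hrein (hP.symm ▸ hpΩ) hab hab'
  have hK := (isCompact_closedBall (0 : ℂ) 1).image_of_continuousOn (hc₁.prodMk hc₂)
  have hK' := (isCompact_closedBall (0 : ℂ) 1).image_of_continuousOn (hkc₁.prodMk hkc₂)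
  obtain ⟨T, L, hT, hL, hTL⟩ := exists_straightening (hK.union hK') hne (x₀ := P) (by
    rintro _ (⟨ζ, hζ, rfl⟩ | ⟨ζ, hζ, rfl⟩)
    · exact hline ζ hζ
    · have hcC : (c : ℂ) ≠ 0 := by exact_mod_cast hc
      have := hline' ζ hζ
      push_cast at this
      apply mul_left_cancel₀ hcC
      linear_combination this)
  have hfT : ∀ ζ ∈ Metric.closedBall (0 : ℂ) 1, f ζ ∈ T.source ∧ T (f ζ) ∈ L := fun ζ hζ =>
    he ζ hζ ▸ hTL (h₁ ζ, h₂ ζ) (Or.inl ⟨ζ, hζ, rfl⟩)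
  have hgT : ∀ ζ ∈ Metric.closedBall (0 : ℂ) 1, g ζ ∈ T.source ∧ T (g ζ) ∈ L := fun ζ hζ =>
    hke ζ hζ ▸ hTL (k₁ ζ, k₂ ζ) (Or.inr ⟨ζ, hζ, rfl⟩)
  have hfs : closure (f '' unitDisk) ⊆ T.source := by
    rw [hclf]; rintro _ ⟨ζ, hζ, rfl⟩; exact (hfT ζ hζ).1
  have hgs : closure (g '' unitDisk) ⊆ T.source := by
    rw [hclg]; rintro _ ⟨ζ, hζ, rfl⟩; exact (hgT ζ hζ).1
  have hfL : T '' (f '' unitDisk) ⊆ (L : Set (ℂ × ℂ)) := by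
    rintro _ ⟨_, ⟨ζ, hζ, rfl⟩, rfl⟩; exact (hfT ζ (hsub hζ)).2
  have hgL : T '' (g '' unitDisk) ⊆ (L : Set (ℂ × ℂ)) := by
    rintro _ ⟨_, ⟨ζ, hζ, rfl⟩, rfl⟩; exact (hgT ζ (hsub hζ)).2
  exact ⟨T, L, hT, Set.union_subset hfs hgs, hL, ⟨hT.isAnalyticDisk_image hf hfs, hfL⟩,
    ⟨hT.isAnalyticDisk_image hg hgs, hgL⟩,
    complexLine_unique_of_nontrivial (subset_closure.trans hfs) hL hfL,
    complexLine_unique_of_nontrivial (subset_closure.trans hgs) hL hgL⟩
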